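/- Let $K$ be an algebraically closed field of characteristic $0$, and let $X\subset\mathbb A^n_K$ be a smooth irreducible affine variety whose vanishing ideal is $I=\langle g_1,\dots,g_m\rangle\subset K[x_1,\dots,x_n]$. Let $A=K[x_1,\dots,x_n]/I$ and let $\mathcal V=\mathrm{Der}_K(A)$. Let $J=(\partial g_j/\partial x_i)$ be the Jacobian matrix, let $r$ be its rank over the field of fractions of $A$, and let $N=\dim X=n-r$. A chart of the standard atlas is given by an $r\times r$ minor $h$ of $J$ that is non-zero in $A$, with set of columns $\beta\subset\{1,\dots,n\}$. Its chart parameters $t_1,\dots,t_N$ are the $x_i$ with $i\notin\beta$, in increasing order of $i$, and $\partial/\partial t_i$ denotes the unique $K$-derivation of the localization $A_{(h)}$ with $\partial t_j/\partial t_i=\delta_{ij}$. Every $\eta\in\mathcal V$ is written as $\eta=\sum_i \eta(t_i)\,\partial/\partial t_i$ in $\mathrm{Der}(A_{(h)})$. An $A\mathcal V$-module is a $K$-vector space $M$ that is a module over the commutative algebra $A$ and over the Lie algebra $\mathcal V$, such that $\eta\cdot(f\cdot m)=\eta(f)\cdot m+f\cdot(\eta\cdot m)$ for all $\eta\in\mathcal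 V$, $f\in A$, $m\in M$. Let $(U,\rho)$ be a simple finite-dimensional $\mathfrak{gl}_N(K)$-module. Gauge fields in the chart $h$ are $A_{(h)}$-linear operators $B_1,\dots,B_N$ on $A_{(h)}\otimes_K U$ that commute with $\rho(\mathfrak{gl}_N)$ and satisfy $[\partial/\partial t_i+B_i,\ \partial/\partial t_j+B_j]=0$ for all $i,j$. They make $A_{(h)}\otimes U$ an $A\mathcal V$-module, on which $A$ acts by multiplication and $$\Big(f\frac{\partial}{\partial t_i}\Big)\cdot(a\otimes u)=f\frac{\partial a}{\partial t_i}\otimes u+f\,B_i(a\otimes u)+\sum_{p=1}^N a\frac{\partial f}{\partial t_p}\otimes\rho(E_{pi})u .$$ An $A\mathcal V$-module $M$ is a gauge module which corresponds to $U$ if, for every chart of the standard atlas, there are gauge fields such that $M$ is isomorphic, as an $A\mathcal V$-module, to an $A\mathcal V$-submodule of $A_{(h)}\otimes U$ that is finitely generated over $A$. Let $M$ be a gauge module which corresponds to the simple finite-dimensional $\mathfrak{gl}_N$-module $U$. If $M$ is reducible as a $\mathcal V$-module, that is, if $M$ has a $\mathcal V$-submodule other than $0$ and $M$, then $\Omega_1=\sum_{i=1}^N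 E_{ii}$ acts on $U$ by a scalar from the set $\{0,1,\dots,N\}$. -/

import Mathlib

open MvPolynomial TensorProduct

attribute [local instance 100] LieRing.ofAssociativeRing

namespace GaugeModules

universe u v w

/-! ## The affine variety and its standard atlas

A family `g` of polynomials over an algebraically closed field `K` that generates a prime ideal
describes the irreducible affine variety `X ⊆ 𝔸ⁿ` of its common zeros: the ideal generated by `g`
is then the ideal of all polynomials that vanish on `X`. -/

section Variety

variable {K : Type u} [Field K] {n m : ℕ} (g : Fin m → MvPolynomial (Fin n) K)

/-- The algebra `A = K[x₁, …, xₙ] / ⟨g₁, …, gₘ⟩` of polynomial functions on `X`. -/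
abbrev CoordRing : Type u := MvPolynomial (Fin n) K ⧸ Ideal.span (Set.range g)

/-- The Lie algebra `V = Der(A)` of polynomial vector fields on `X`. -/
abbrev VectorField : Type u := Derivation K (CoordRing g) (CoordRing g)

/-- The coordinate function `xᵢ` on `X`. -/
noncomputable def coord (i : Fin n) : CoordRing g := Ideal.Quotient.mk _ (X i)

/-- The Jacobian matrix `J = (∂gⱼ/∂xᵢ)`, with entries in `A`. -/
noncomputable def jacobian : Matrix (Fin m) (Fin n) (CoordRing g) :=
  Matrix.of fun j i => Ideal.Quotient.mk _ (pderiv i (g j))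

/-- The rank `r` of the Jacobian matrix over the field of rational functions on `X`. -/
noncomputable def jacobianRank : ℕ :=
  ((jacobian g).map (algebraMap (CoordRing g) (FractionRing (CoordRing g)))).rank

/-- The dimension `N = n - r` of `X`. -/
noncomputable def dim : ℕ := n - jacobianRank g

/-- A chart of the standard atlas: the choice of `r` rows and `r` columns of `J` such that the
corresponding `r × r` minor `h` is non-zero in `A`. The chart domain is `{p ∈ X | h(p) ≠ 0}`. -/
structure Chart where
  /-- The rows of the minor. -/
  rows : Fin (jacobianRank g) ↪o Fin m
  /-- The columns of the minor. -/
  cols : Fin (jacobianRank g) ↪o Fin n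
  /-- The minor does not vanish identically on `X`. -/
  det_ne_zero : ((jacobian g).submatrix rows cols).det ≠ 0

/-- Let `R` be a localization of `A` at one element. A vector with entries in `R` that is
annihilated by the Jacobian matrix comes from a derivation of `R`. -/
lemma exists_derivation {R : Type u} [CommRing R] [Algebra K R] [Algebra (CoordRing g) R]
    [IsScalarTower K (CoordRing g) R] (h : CoordRing g) [IsLocalization.Away h R]
    (v : Fin n → R) (hv : ∀ l, ∑ k, algebraMap (CoordRing g) R (jacobian g l k) * v k = 0) :
    ∃ D : Derivation K R R, ∀ k, D (algebraMap (CoordRing g) R (coord g k)) = v k := by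
  let F₀ : MvPolynomial (Fin n) K →ₐ[K] TrivSqZeroExt R R :=
    aeval fun k => (TrivSqZeroExt.inl (algebraMap (CoordRing g) R (coord g k)) +
      TrivSqZeroExt.inr (v k) : TrivSqZeroExt R R)
  let ev : MvPolynomial (Fin n) K →ₐ[K] R :=
    (IsScalarTower.toAlgHom K (CoordRing g) R).comp (Ideal.Quotient.mkₐ K _)
  have hX : ∀ k, F₀ (X k) = TrivSqZeroExt.inl (algebraMap (CoordRing g) R (coord g k)) +
      TrivSqZeroExt.inr (v k) := fun k => aeval_X _ k
  have hfst : ∀ p, (F₀ p).fst = ev p := by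
    intro p
    have : (TrivSqZeroExt.fstHom K R R).comp F₀ = ev := by
      apply MvPolynomial.algHom_ext
      intro k
      rw [AlgHom.comp_apply, hX]
      change (TrivSqZeroExt.inl _ + TrivSqZeroExt.inr _ : TrivSqZeroExt R R).fst = _
      rw [TrivSqZeroExt.fst_add, TrivSqZeroExt.fst_inl, TrivSqZeroExt.fst_inr, add_zero]
      rfl
    exact DFunLike.congr_fun this p
  have hsnd : ∀ p, (F₀ p).snd = ∑ k, ev (pderiv k p) * v k := by
    intro p
    induction p using MvPolynomial.induction_on with
    | C a =>
      simp only [pderiv_C, map_zero, zero_mul, Finset.sum_const_zero]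
      have : F₀ (C a) = algebraMap K _ a := F₀.commutes a
      rw [this, TrivSqZeroExt.algebraMap_eq_inl']
      exact TrivSqZeroExt.snd_inl _ _
    | add p q hp hq =>
      simp only [map_add, TrivSqZeroExt.snd_add, hp, hq, add_mul, Finset.sum_add_distrib]
    | mul_X p k hp =>
      have e1 : (F₀ (X k)).snd = v k := by
        rw [hX, TrivSqZeroExt.snd_add, TrivSqZeroExt.snd_inl, TrivSqZeroExt.snd_inr, zero_add]
      rw [map_mul, TrivSqZeroExt.snd_mul, hp, hfst, e1, hfst]
      simp only [Derivation.leibniz, pderiv_X, smul_eq_mul, map_add, map_mul, add_mul,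
        Finset.sum_add_distrib, MulOpposite.smul_eq_mul_unop, MulOpposite.unop_op]
      congr 1
      · rw [Finset.sum_eq_single k]
        · simp
        · intro b _ hb
          simp [hb.symm]
        · simp
      · rw [Finset.sum_mul]
        exact Finset.sum_congr rfl fun i _ => by ring
  have hg : ∀ a ∈ Ideal.span (Set.range g), F₀ a = 0 := by
    have : Ideal.span (Set.range g) ≤ RingHom.ker F₀ := by
      rw [Ideal.span_le]
      rintro _ ⟨l, rfl⟩
      rw [SetLike.mem_coe, RingHom.mem_ker]
      apply TrivSqZeroExt.ext
      · rw [hfst]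
        change algebraMap (CoordRing g) R (Ideal.Quotient.mk _ (g l)) = 0
        rw [Ideal.Quotient.eq_zero_iff_mem.2 (Ideal.subset_span (Set.mem_range_self l)), map_zero]
      · rw [hsnd]
        exact hv l
    exact fun a ha => this ha
  let F₁ : CoordRing g →ₐ[K] TrivSqZeroExt R R := Ideal.Quotient.liftₐ _ F₀ hg
  have hF₁ : ∀ a, (F₁ a).fst = algebraMap (CoordRing g) R a := by
    intro a
    obtain ⟨p, rfl⟩ := Ideal.Quotient.mk_surjective a
    exact hfst p
  have hu : IsUnit (F₁ h) := by
    rw [TrivSqZeroExt.isUnit_iff_isUnit_fst, hF₁]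
    exact IsLocalization.Away.algebraMap_isUnit _
  let F₂ : R →+* TrivSqZeroExt R R := IsLocalization.Away.lift h (g := F₁.toRingHom) hu
  have hF₂ : ∀ a, F₂ (algebraMap (CoordRing g) R a) = F₁ a := fun a =>
    IsLocalization.Away.lift_eq h hu a
  have hF₂fst : ∀ x, (F₂ x).fst = x := by
    have : (TrivSqZeroExt.fstHom K R R).toRingHom.comp F₂ = RingHom.id R := by
      apply IsLocalization.ringHom_ext (Submonoid.powers h)
      refine RingHom.ext fun a => ?_
      change (F₂ (algebraMap (CoordRing g) R a)).fst = _
      rw [hF₂, hF₁]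
      rfl
    exact fun x => DFunLike.congr_fun this x
  have hF₂K : ∀ a : K, F₂ (algebraMap K R a) = algebraMap K _ a := by
    intro a
    rw [IsScalarTower.algebraMap_apply K (CoordRing g) R, hF₂]
    exact F₁.commutes a
  refine ⟨Derivation.mk' { toFun := fun x => (F₂ x).snd, map_add' := ?_, map_smul' := ?_ } ?_, ?_⟩
  · intro x y
    rw [map_add, TrivSqZeroExt.snd_add]
  · intro a x
    rw [Algebra.smul_def, map_mul, hF₂K, TrivSqZeroExt.snd_mul,
      TrivSqZeroExt.algebraMap_eq_inl', TrivSqZeroExt.snd_inl, TrivSqZeroExt.fst_inl]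
    simp [Algebra.smul_def]
  · intro a b
    change (F₂ (a * b)).snd = a • (F₂ b).snd + b • (F₂ a).snd
    rw [map_mul, TrivSqZeroExt.snd_mul, hF₂fst, hF₂fst]
    simp [mul_comm]
  · intro k
    change (F₂ (algebraMap (CoordRing g) R (coord g k))).snd = v k
    rw [hF₂]
    change (F₀ (X k)).snd = v k
    rw [hX, TrivSqZeroExt.snd_add, TrivSqZeroExt.snd_inl, TrivSqZeroExt.snd_inr, zero_add]

/-- A derivation of `A_(h)` maps the relation `gₗ = 0` to `∑ₖ ∂gₗ/∂xₖ · D(xₖ) = 0`. -/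
lemma sum_jacobian_mul_derivation {R : Type u} [CommRing R] [Algebra K R]
    [Algebra (CoordRing g) R] [IsScalarTower K (CoordRing g) R] (D : Derivation K R R)
    (l : Fin m) : ∑ k, algebraMap (CoordRing g) R (jacobian g l k) *
      D (algebraMap (CoordRing g) R (coord g k)) = 0 := by
  let ev : MvPolynomial (Fin n) K →ₐ[K] R :=
    (IsScalarTower.toAlgHom K (CoordRing g) R).comp (Ideal.Quotient.mkₐ K _)
  have key : ∀ p, D (ev p) = ∑ k, ev (pderiv k p) * D (ev (X k)) := by
    intro p
    induction p using MvPolynomial.induction_on with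
    | C a =>
      have : ev (C a) = algebraMap K R a := ev.commutes a
      simp [this]
    | add p q hp hq => simp only [map_add, hp, hq, add_mul, Finset.sum_add_distrib]
    | mul_X p k hp =>
      rw [map_mul, Derivation.leibniz, hp]
      simp only [Derivation.leibniz, pderiv_X, smul_eq_mul, map_add, map_mul, add_mul,
        Finset.sum_add_distrib]
      congr 1
      · rw [Finset.sum_eq_single k]
        · simp
        · intro b _ hb
          simp [hb.symm]
        · simp
      · rw [Finset.mul_sum]
        exact Finset.sum_congr rfl fun i _ => by ring
  have h0 : ev (g l) = 0 := by
    change algebraMap (CoordRing g) R (Ideal.Quotient.mk _ (g l)) = 0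
    rw [Ideal.Quotient.eq_zero_iff_mem.2 (Ideal.subset_span (Set.mem_range_self l)), map_zero]
  have h1 := key (g l)
  rw [h0, map_zero] at h1
  exact h1.symm

namespace Chart

variable {g} (c : Chart g)

/-- The minor `h` of the chart. -/
noncomputable def minor : CoordRing g := ((jacobian g).submatrix c.rows c.cols).det

/-- The localized algebra `A_(h)`. -/
abbrev LocRing : Type u := Localization.Away c.minor

lemma card_compl_cols :
    ((Finset.univ.map c.cols.toEmbedding)ᶜ : Finset (Fin n)).card = dim g := by
  rw [Finset.card_compl, Finset.card_map, Finset.card_univ, Fintype.card_fin, Fintype.card_fin, dim]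

/-- The indices `i ∉ β` of the columns outside the minor, in increasing order. -/
noncomputable def paramIndex : Fin (dim g) ↪o Fin n :=
  ((Finset.univ.map c.cols.toEmbedding)ᶜ).orderEmbOfFin c.card_compl_cols

/-- The chart parameters `t₁, …, t_N`: the coordinate functions `xᵢ` with `i ∉ β`, in increasing
order of `i`. -/
noncomputable def param (i : Fin (dim g)) : CoordRing g := coord g (c.paramIndex i)

lemma paramIndex_ne (i : Fin (dim g)) (s : Fin (jacobianRank g)) :
    c.paramIndex i ≠ c.cols s := by
  intro h
  have := Finset.orderEmbOfFin_mem _ c.card_compl_cols i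
  rw [← paramIndex, h] at this
  simp at this

lemma eq_paramIndex_or_eq_cols (k : Fin n) :
    (∃ i, k = c.paramIndex i) ∨ ∃ s, k = c.cols s := by
  by_cases h : k ∈ (Finset.univ.map c.cols.toEmbedding)ᶜ
  · left
    have := Finset.range_orderEmbOfFin _ c.card_compl_cols
    have hk : k ∈ Set.range c.paramIndex := by rw [paramIndex, this]; exact h
    obtain ⟨i, hi⟩ := hk
    exact ⟨i, hi.symm⟩
  · right
    simp only [Finset.mem_compl, Finset.mem_map, Finset.mem_univ, true_and, not_not] at h
    obtain ⟨s, hs⟩ := h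
    exact ⟨s, hs.symm⟩

/-- The image of the Jacobian matrix in `A_(h)`. -/
noncomputable def locJacobian : Matrix (Fin m) (Fin n) c.LocRing :=
  (jacobian g).map (algebraMap (CoordRing g) c.LocRing)

lemma isUnit_det : IsUnit (c.locJacobian.submatrix c.rows c.cols).det := by
  have : (c.locJacobian.submatrix c.rows c.cols).det
      = algebraMap (CoordRing g) c.LocRing c.minor :=
    (RingHom.map_det (algebraMap (CoordRing g) c.LocRing) ((jacobian g).submatrix c.rows c.cols)).symm
  rw [this]
  exact IsLocalization.Away.algebraMap_isUnit _

/-- A derivation of `A_(h)` is determined by its values on the chart parameters. -/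
lemma derivation_ext {D D' : Derivation K c.LocRing c.LocRing}
    (h : ∀ j, D (algebraMap (CoordRing g) c.LocRing (c.param j))
      = D' (algebraMap (CoordRing g) c.LocRing (c.param j))) : D = D' := by
  have hcoord : ∀ k, D (algebraMap (CoordRing g) c.LocRing (coord g k))
      = D' (algebraMap (CoordRing g) c.LocRing (coord g k)) := by
    set w : Fin n → c.LocRing := fun k =>
      (D - D') (algebraMap (CoordRing g) c.LocRing (coord g k)) with hw
    have hw0 : ∀ i, w (c.paramIndex i) = 0 := fun i => by
      rw [hw]
      exact sub_eq_zero.2 (h i)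
    let S := c.locJacobian.submatrix c.rows c.cols
    have hS : S.mulVec (fun s => w (c.cols s)) = 0 := by
      funext s
      have h1 : ∑ k, c.locJacobian (c.rows s) k * w k = 0 :=
        sum_jacobian_mul_derivation g (D - D') (c.rows s)
      have h2 : ∑ t, c.locJacobian (c.rows s) (c.cols t) * w (c.cols t)
          = ∑ k, c.locJacobian (c.rows s) k * w k := by
        refine (Finset.sum_map Finset.univ c.cols.toEmbedding
          (fun k => c.locJacobian (c.rows s) k * w k)).symm.trans ?_
        apply Finset.sum_subset (Finset.subset_univ _)
        intro k _ hk
        rcases c.eq_paramIndex_or_eq_cols k with ⟨i, rfl⟩ | ⟨t, rfl⟩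
        · rw [hw0, mul_zero]
        · exact absurd (Finset.mem_map_of_mem c.cols.toEmbedding (Finset.mem_univ t)) hk
      exact h2.trans h1
    have hw1 : (fun s => w (c.cols s)) = 0 := by
      have h3 : S⁻¹.mulVec (S.mulVec fun s => w (c.cols s)) = fun s => w (c.cols s) := by
        rw [Matrix.mulVec_mulVec, Matrix.nonsing_inv_mul _ c.isUnit_det, Matrix.one_mulVec]
      rw [← h3, hS, Matrix.mulVec_zero]
    intro k
    apply sub_eq_zero.1
    change w k = 0
    rcases c.eq_paramIndex_or_eq_cols k with ⟨i, rfl⟩ | ⟨t, rfl⟩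
    · exact hw0 i
    · exact congrFun hw1 t
  have hA : ∀ a, D (algebraMap (CoordRing g) c.LocRing a)
      = D' (algebraMap (CoordRing g) c.LocRing a) := by
    intro a
    obtain ⟨p, rfl⟩ := Ideal.Quotient.mk_surjective a
    induction p using MvPolynomial.induction_on with
    | C a =>
      have : algebraMap (CoordRing g) c.LocRing (Ideal.Quotient.mk _ (C a))
          = algebraMap K c.LocRing a :=
        (IsScalarTower.algebraMap_apply K (CoordRing g) c.LocRing a).symm
      rw [this, Derivation.map_algebraMap, Derivation.map_algebraMap]
    | add p q hp hq => rw [map_add, map_add, map_add, map_add, hp, hq]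
    | mul_X p k hp =>
      have := hcoord k
      rw [coord] at this
      rw [map_mul, map_mul, Derivation.leibniz, Derivation.leibniz, hp, this]
  apply Derivation.ext
  intro x
  obtain ⟨k, a, ha⟩ := IsLocalization.Away.surj c.minor x
  have hu : IsUnit (algebraMap (CoordRing g) c.LocRing c.minor ^ k) :=
    (IsLocalization.Away.algebraMap_isUnit _).pow k
  have h1 := congrArg D ha
  have h2 := congrArg D' ha
  rw [← map_pow] at h1 h2 hu
  rw [Derivation.leibniz, smul_eq_mul, smul_eq_mul, hA, hA] at h1
  rw [Derivation.leibniz, smul_eq_mul, smul_eq_mul, ← h1] at h2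
  exact (hu.mul_left_cancel (add_left_cancel h2)).symm

section Existence

variable [hI : (Ideal.span (Set.range g)).IsPrime]

/-- Every vector annihilated by the chosen `r` rows of `J` is annihilated by all rows. -/
lemma locJacobian_mulVec_eq_zero (v : Fin n → c.LocRing)
    (hv : ∀ s, (c.locJacobian.mulVec v) (c.rows s) = 0) : c.locJacobian.mulVec v = 0 := by
  classical
  let F := FractionRing (CoordRing g)
  have hh : c.minor ≠ 0 := c.det_ne_zero
  have hle : Submonoid.powers c.minor ≤ nonZeroDivisors (CoordRing g) :=
    powers_le_nonZeroDivisors_of_noZeroDivisors hh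
  have hunit : IsUnit (algebraMap (CoordRing g) F c.minor) := by
    rw [isUnit_iff_ne_zero]
    exact (map_ne_zero_iff _ (IsFractionRing.injective (CoordRing g) F)).2 hh
  let φ : c.LocRing →+* F := IsLocalization.Away.lift c.minor hunit
  have hφ : ∀ a, φ (algebraMap _ _ a) = algebraMap (CoordRing g) F a := fun a =>
    IsLocalization.Away.lift_eq c.minor hunit a
  have hφi : Function.Injective φ := by
    rw [injective_iff_map_eq_zero]
    intro x hx
    obtain ⟨k, a, ha⟩ := IsLocalization.Away.surj c.minor x
    have h1 : algebraMap (CoordRing g) F a = 0 := by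
      rw [← hφ, ← ha, map_mul, hx, zero_mul]
    have h2 : a = 0 := (map_eq_zero_iff _ (IsFractionRing.injective (CoordRing g) F)).1 h1
    rw [h2, map_zero] at ha
    have hu : IsUnit (algebraMap (CoordRing g) c.LocRing c.minor ^ k) :=
      (IsLocalization.Away.algebraMap_isUnit _).pow k
    exact (hu.mul_left_eq_zero).1 ha
  set JF : Matrix (Fin m) (Fin n) F := (jacobian g).map (algebraMap (CoordRing g) F) with hJF
  have hmap : ∀ (l : Fin m), φ (c.locJacobian.mulVec v l) = JF.mulVec (fun k => φ (v k)) l := by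
    intro l
    simp [Matrix.mulVec, dotProduct, locJacobian, hφ, hJF, map_sum]
  let S : Matrix (Fin (jacobianRank g)) (Fin n) F := JF.submatrix c.rows id
  have hSdet : (S.submatrix id c.cols).det ≠ 0 := by
    have : (S.submatrix id c.cols).det = algebraMap (CoordRing g) F c.minor :=
      (RingHom.map_det (algebraMap (CoordRing g) F) ((jacobian g).submatrix c.rows c.cols)).symm
    rw [this]
    exact hunit.ne_zero
  have hSrank : jacobianRank g ≤ S.rank := by
    have h1 : (S.submatrix id c.cols).rank = jacobianRank g := by
      rw [Matrix.rank_of_isUnit _ ((Matrix.isUnit_iff_isUnit_det _).2 hSdet.isUnit)]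
      simp
    exact h1.symm.le.trans (Matrix.rank_submatrix_le _ _ _)
  have hker : LinearMap.ker JF.mulVecLin = LinearMap.ker S.mulVecLin := by
    have hle : LinearMap.ker JF.mulVecLin ≤ LinearMap.ker S.mulVecLin := by
      intro x hx
      rw [LinearMap.mem_ker, Matrix.mulVecLin_apply] at hx ⊢
      funext s
      exact congrFun hx (c.rows s)
    apply Submodule.eq_of_le_of_finrank_le hle
    have e1 := LinearMap.finrank_range_add_finrank_ker JF.mulVecLin
    have e2 := LinearMap.finrank_range_add_finrank_ker S.mulVecLin
    have e3 : Module.finrank F (LinearMap.range JF.mulVecLin) = jacobianRank g := rfl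
    have e4 : Module.finrank F (LinearMap.range S.mulVecLin) = S.rank := rfl
    omega
  have hmem : (fun k => φ (v k)) ∈ LinearMap.ker S.mulVecLin := by
    rw [LinearMap.mem_ker, Matrix.mulVecLin_apply]
    funext s
    have := hmap (c.rows s)
    rw [hv s, map_zero] at this
    exact this.symm
  rw [← hker, LinearMap.mem_ker, Matrix.mulVecLin_apply] at hmem
  funext l
  apply hφi
  rw [hmap l, hmem]
  simp

/-- For each `i` there is a derivation `∂/∂tᵢ` of `A_(h)` with `∂tⱼ/∂tᵢ = δᵢⱼ`. -/
lemma exists_partial (i : Fin (dim g)) :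
    ∃ D : Derivation K c.LocRing c.LocRing, ∀ j,
      D (algebraMap (CoordRing g) c.LocRing (c.param j)) = if j = i then 1 else 0 := by
  classical
  let S := c.locJacobian.submatrix c.rows c.cols
  let b : Fin (jacobianRank g) → c.LocRing :=
    -(S⁻¹.mulVec fun s => c.locJacobian (c.rows s) (c.paramIndex i))
  let v : Fin n → c.LocRing := fun k =>
    if k = c.paramIndex i then 1 else ∑ s, if k = c.cols s then b s else 0
  have hv1 : ∀ j, v (c.paramIndex j) = if j = i then 1 else 0 := by
    intro j
    by_cases hj : j = i
    · simp [v, hj]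
    · have : c.paramIndex j ≠ c.paramIndex i := fun h => hj (c.paramIndex.injective h)
      simp [v, this, hj, paramIndex_ne]
  have hsum : ∀ a : Fin n → c.LocRing,
      ∑ k, a k * v k = a (c.paramIndex i) + ∑ s, a (c.cols s) * b s := by
    intro a
    have hvv : ∀ k, v k = (if k = c.paramIndex i then 1 else 0)
        + ∑ s, if k = c.cols s then b s else 0 := by
      intro k
      by_cases hk : k = c.paramIndex i
      · simp [v, hk, paramIndex_ne]
      · simp [v, hk]
    simp only [hvv, mul_add, Finset.sum_add_distrib, Finset.mul_sum]
    congr 1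
    · simp
    · rw [Finset.sum_comm]
      simp
  obtain ⟨D, hD⟩ := exists_derivation g c.minor v (congrFun (c.locJacobian_mulVec_eq_zero v (by
    intro s
    rw [Matrix.mulVec, dotProduct, hsum]
    have h2 : S.mulVec b = -fun s => c.locJacobian (c.rows s) (c.paramIndex i) := by
      simp only [b]
      rw [Matrix.mulVec_neg, Matrix.mulVec_mulVec, Matrix.mul_nonsing_inv _ c.isUnit_det,
        Matrix.one_mulVec]
    have h3 := congrFun h2 s
    simp only [Matrix.mulVec, dotProduct, S, Matrix.submatrix_apply, Pi.neg_apply] at h3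
    rw [h3, add_neg_cancel])))
  exact ⟨D, fun j => by rw [param, hD, hv1]⟩

/-- The derivation `∂/∂tᵢ` of `A_(h)`: the unique extension of the partial derivative of
`K[t₁, …, t_N]`, that is, the unique `K`-derivation of `A_(h)` with `∂tⱼ/∂tᵢ = δᵢⱼ`. -/
noncomputable def partialDeriv (i : Fin (dim g)) : Derivation K c.LocRing c.LocRing :=
  (c.exists_partial i).choose

lemma partialDeriv_param (i j : Fin (dim g)) :
    c.partialDeriv i (algebraMap (CoordRing g) c.LocRing (c.param j)) = if j = i then 1 else 0 :=
  (c.exists_partial i).choose_spec j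

end Existence

end Chart

end Variety

/-! ## `AV`-modules and gauge modules -/

section Modules

variable {K : Type u} [Field K] {n m : ℕ} (g : Fin m → MvPolynomial (Fin n) K)

/-- The compatibility `η·(f·m) = η(f)·m + f·(η·m)` of an `A`-module structure and a `V`-module
structure on the vector space `M`, which makes `M` an `AV`-module. -/
class IsAVModule (M : Type w) [AddCommGroup M] [Module (CoordRing g) M]
    [LieRingModule (VectorField g) M] : Prop where
  leibniz : ∀ (η : VectorField g) (f : CoordRing g) (x : M), ⁅η, f • x⁆ = η f • x + f • ⁅η, x⁆

/-- The Lie algebra `gl_N`, `N = dim X`. -/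
abbrev Gl : Type u := Matrix (Fin (dim g)) (Fin (dim g)) K

variable {g}

namespace Chart

variable (c : Chart g) (U : Type v) [AddCommGroup U] [Module K U]

/-- The space `A_(h) ⊗ U`. -/
abbrev LocTensor : Type (max u v) := c.LocRing ⊗[K] U

variable [(Ideal.span (Set.range g)).IsPrime]

/-- The operator `∂/∂tᵢ + Bᵢ` on `A_(h) ⊗ U`, where `∂/∂tᵢ` acts on the first factor. -/
noncomputable def covDeriv (B : Fin (dim g) → Module.End c.LocRing (c.LocTensor U))
    (i : Fin (dim g)) : Module.End K (c.LocTensor U) :=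
  LinearMap.rTensor U (c.partialDeriv i : c.LocRing →ₗ[K] c.LocRing) + (B i).restrictScalars K

variable [LieRingModule (Gl g) U] [LieModule K (Gl g) U]

/-- Gauge fields on `A_(h) ⊗ U` for a `gl_N`-module `(U, ρ)`: `A_(h)`-linear operators
`B₁, …, B_N` that commute with `ρ(gl_N)` and satisfy `[∂/∂tᵢ + Bᵢ, ∂/∂tⱼ + Bⱼ] = 0`. -/
structure GaugeFields where
  /-- The operators `Bᵢ`. -/
  field : Fin (dim g) → Module.End c.LocRing (c.LocTensor U)
  field_comm : ∀ (i : Fin (dim g)) (x : Gl g),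
    Commute (field i) ((LieModule.toEnd K (Gl g) U x).baseChange c.LocRing)
  flat : ∀ i j : Fin (dim g), ⁅c.covDeriv U field i, c.covDeriv U field j⁆ = 0

variable {c U}

/-- The action of the derivation `∑ᵢ fᵢ ∂/∂tᵢ` of `A_(h)` on `A_(h) ⊗ U`:
`(fᵢ ∂/∂tᵢ)·(a ⊗ u) = fᵢ ∂a/∂tᵢ ⊗ u + fᵢ Bᵢ(a ⊗ u) + ∑ₚ a ∂fᵢ/∂tₚ ⊗ ρ(Eₚᵢ)u`. -/
noncomputable def GaugeFields.action (B : c.GaugeFields U) (f : Fin (dim g) → c.LocRing)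
    (x : c.LocTensor U) : c.LocTensor U :=
  ∑ i, (f i • c.covDeriv U B.field i x +
    ∑ p, c.partialDeriv p (f i) •
      (LieModule.toEnd K (Gl g) U (Matrix.single p i 1)).baseChange c.LocRing x)

/-- The action of a vector field `η ∈ V = Der(A)`, which is `∑ᵢ η(tᵢ) ∂/∂tᵢ` as a derivation
of `A_(h)`. -/
noncomputable def GaugeFields.vectorFieldAction (B : c.GaugeFields U) (η : VectorField g)
    (x : c.LocTensor U) : c.LocTensor U :=
  B.action (fun i => algebraMap (CoordRing g) c.LocRing (η (c.param i))) x

end Chart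

variable (g)

/-- `M` is a gauge module which corresponds to the `gl_N`-module `U`: for every chart of the
standard atlas, there are gauge fields on `A_(h) ⊗ U` such that `M` is isomorphic as an
`AV`-module to a local gauge module, that is, to an `AV`-submodule `L` of `A_(h) ⊗ U` that is
finitely generated over `A`. -/
def IsGaugeModule [(Ideal.span (Set.range g)).IsPrime]
    (U : Type v) [AddCommGroup U] [Module K U] [LieRingModule (Gl g) U] [LieModule K (Gl g) U]
    (M : Type w) [AddCommGroup M] [Module (CoordRing g) M] [LieRingModule (VectorField g) M] :
    Prop :=
  ∀ c : Chart g, ∃ (B : c.GaugeFields U) (L : Submodule (CoordRing g) (c.LocTensor U)),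
    L.FG ∧ (∀ (η : VectorField g), ∀ x ∈ L, B.vectorFieldAction η x ∈ L) ∧
    ∃ e : M ≃ₗ[CoordRing g] L, ∀ (η : VectorField g) (x : M),
      (e ⁅η, x⁆ : c.LocTensor U) = B.vectorFieldAction η (e x)

/-- `M` is reducible as a `V`-module: it has a `V`-submodule other than `0` and `M`. -/
def IsReducible (M : Type w) [AddCommGroup M] [Module K M] [LieRingModule (VectorField g) M]
    [LieModule K (VectorField g) M] : Prop :=
  ∃ M' : LieSubmodule K (VectorField g) M, M' ≠ ⊥ ∧ M' ≠ ⊤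

end Modules

end GaugeModules

/-! One chart suffices. Call `symbol f η` the operator (fη)· − f(η·). In the chart it is the sum of
η(tᵢ) ∂f/∂tₚ ρ(Eₚᵢ): the gauge fields cancel, and it is linear over functions in η and in the vector
it acts on. Consequently the combination `quadDiff` of products of two vector fields has no second
order part (`quadDiff_eq`), and multiplying it by a function only changes its argument η
(`smul_quadDiff`).

Let M' be a proper non-zero V-submodule. The A-span of the values of `quadDiff` on M' is V-stable
and, since it is still expressed by vector fields, lies in M'. As M is simple as an AV-module
(`eq_top_of_stable`), this span is zero; as M' spans M over A, `quadDiff` vanishes on M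
(`quadDiff_eq_zero`). For f = g = tᵢ and η = μ a multiple of ∂/∂tᵢ this says ρ(Eᵢᵢ)² = ρ(Eᵢᵢ). A sum
of N commuting idempotents that is central in gl_N acts on the simple module U by an integer between
0 and N (`exists_sum_lie_eq_natCast_smul`).

Simplicity over AV has two ingredients. By Burnside's theorem, a non-zero AV-submodule contains bM
for some non-zero b in A (`exists_smul_mem_of_lie_stable`, then clearing of denominators). The
multipliers b form an ideal stable under derivations, and a smooth A has no proper non-zero such
ideal (`eq_bot_of_derivation_stable`). -/

namespace GaugeModules

/-! ### Differential simplicity of smooth affine domains -/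

section DifferentialSimplicity

variable {K A : Type*} [Field K] [CommRing A] [Algebra K A]

/-- The derivation `a ↦ a - a(p)` from `A` to the cotangent space at a `K`-point `p`. -/
noncomputable def cotangentDerivation (p : A →ₐ[K] K) :
    Derivation K A (RingHom.ker p).Cotangent :=
  Derivation.mk'
    { toFun := fun a => (RingHom.ker p).toCotangent
        ⟨a - algebraMap K A (p a), by simp [RingHom.mem_ker]⟩
      map_add' := fun a b => by
        rw [← map_add]
        congr 1
        apply Subtype.ext
        simp only [map_add, Submodule.coe_add]
        ring
      map_smul' := fun k a => by
        rw [RingHom.id_apply, ← algebraMap_smul A k ((RingHom.ker p).toCotangent _), ← map_smul]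
        congr 1
        apply Subtype.ext
        simp [Algebra.smul_def, mul_sub] }
    (by
      intro a b
      simp only [LinearMap.coe_mk, AddHom.coe_mk]
      rw [← map_smul, ← map_smul, ← map_add, Ideal.toCotangent_eq]
      have h : ∀ x : A, x - algebraMap K A (p x) ∈ RingHom.ker p := fun x => by
        simp [RingHom.mem_ker]
      have h2 := Ideal.mul_mem_mul (h a) (h b)
      rw [← pow_two] at h2
      convert neg_mem h2 using 1
      simp
      ring)

lemma cotangentDerivation_apply (p : A →ₐ[K] K) (a : A) (h : a - algebraMap K A (p a) ∈ RingHom.ker p) :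
    cotangentDerivation p a = (RingHom.ker p).toCotangent ⟨a - algebraMap K A (p a), h⟩ := rfl

/-- If `Ω[A⁄K]` is projective, there is a derivation which acts on the cotangent space at a
`K`-point `p` as the identity and which maps every derivation-stable ideal `J` to `m_p J`. -/
lemma exists_euler_derivation [Module.Projective A Ω[A⁄K]] (p : A →ₐ[K] K) :
    ∃ E : Derivation K A A, (∀ a, E a ∈ RingHom.ker p) ∧
      (∀ a ∈ RingHom.ker p, E a - a ∈ RingHom.ker p ^ 2) ∧
      ∀ J : Ideal A, (∀ D : Derivation K A A, ∀ a ∈ J, D a ∈ J) →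
        ∀ a ∈ J, E a ∈ RingHom.ker p * J := by
  have hk : ∀ x : A, x - algebraMap K A (p x) ∈ RingHom.ker p := fun x => by simp [RingHom.mem_ker]
  have hsurj : Function.Surjective
      (Finsupp.linearCombination A (KaehlerDifferential.D K A : A → Ω[A⁄K])) := by
    rw [← LinearMap.range_eq_top, Finsupp.range_linearCombination,
      KaehlerDifferential.span_range_derivation]
  -- Projectivity splits the presentation of Ω by all differentials: da = ∑ cₓ dx with cₓ linear in
  -- da. Then E a = ∑ cₓ (x − x(p)) is an Euler field centred at p.
  obtain ⟨s, hs⟩ := Module.projective_lifting_property _ (LinearMap.id : Ω[A⁄K] →ₗ[A] _) hsurj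
  let φ : (A →₀ A) →ₗ[A] A := Finsupp.linearCombination A fun x => x - algebraMap K A (p x)
  let E : Derivation K A A := (φ.comp s).compDer (KaehlerDifferential.D K A)
  have hE : ∀ a, E a = (s (KaehlerDifferential.D K A a)).sum
      fun x c => c * (x - algebraMap K A (p x)) := fun a => rfl
  have hEm : ∀ a, E a ∈ RingHom.ker p := fun a => by
    rw [hE]
    exact Ideal.sum_mem _ fun x _ => Ideal.mul_mem_left _ _ (hk x)
  refine ⟨E, hEm, ?_, ?_⟩
  · intro a ha
    -- Applying the linear map induced by `cotangentDerivation p` to da = ∑ cₓ dx identifies the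
    -- class of E a with that of a − a(p).
    have h1 : cotangentDerivation p a = (RingHom.ker p).toCotangent ⟨E a, hEm a⟩ := by
      have h2 : KaehlerDifferential.D K A a =
          Finsupp.linearCombination A (KaehlerDifferential.D K A : A → Ω[A⁄K])
            (s (KaehlerDifferential.D K A a)) := (LinearMap.congr_fun hs _).symm
      rw [← Derivation.liftKaehlerDifferential_comp_D (cotangentDerivation p) a, h2,
        Finsupp.linearCombination_apply, Finsupp.sum, map_sum]
      have h3 : (⟨E a, hEm a⟩ : RingHom.ker p) = ∑ x ∈ (s (KaehlerDifferential.D K A a)).support,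
          (s (KaehlerDifferential.D K A a)) x •
            (⟨x - algebraMap K A (p x), hk x⟩ : RingHom.ker p) := by
        apply Subtype.ext
        rw [AddSubmonoidClass.coe_finsetSum]
        rfl
      rw [h3, map_sum]
      refine Finset.sum_congr rfl fun x _ => ?_
      rw [map_smul, map_smul, Derivation.liftKaehlerDifferential_comp_D]
      rfl
    rw [cotangentDerivation_apply p a (hk a), eq_comm, Ideal.toCotangent_eq] at h1
    rw [RingHom.mem_ker] at ha
    simpa [ha] using h1
  · intro J hJ a ha
    rw [hE]
    refine Ideal.sum_mem _ fun x _ => ?_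
    -- Each coefficient cₓ is itself a derivation as a function of a, so it maps J to J.
    have h1 := hJ (((Finsupp.lapply x).comp s).compDer (KaehlerDifferential.D K A)) a ha
    rw [mul_comm (RingHom.ker p)]
    exact Ideal.mul_mem_mul h1 (hk x)

/-- By the Leibniz rule, a field that is the identity on I/I² acts on Iˢ/Iˢ⁺¹ as the degree s, like
Euler's field on homogeneous forms. -/
lemma derivation_sub_smul_mem_pow {I : Ideal A} (E : Derivation K A A) (h0 : ∀ a, E a ∈ I)
    (h1 : ∀ a ∈ I, E a - a ∈ I ^ 2) (s : ℕ) : ∀ a ∈ I ^ s, E a - s • a ∈ I ^ (s + 1) := by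
  induction s with
  | zero => intro a _; simpa using h0 a
  | succ s ih =>
    intro a ha
    rw [pow_succ] at ha
    induction ha using Submodule.mul_induction_on' with
    | mem_mul_mem b hb c hc =>
      have e : E (b * c) - (s + 1) • (b * c) = b * (E c - c) + (E b - s • b) * c := by
        simp only [Derivation.leibniz, smul_eq_mul, nsmul_eq_mul]
        push_cast
        ring
      rw [e]
      refine add_mem ?_ ?_
      · have := Ideal.mul_mem_mul hb (h1 c hc)
        rwa [← pow_add] at this
      · have := Ideal.mul_mem_mul (ih b hb) hc
        rwa [← pow_succ] at this
    | add x _ y _ hx hy =>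
      have e : E (x + y) - (s + 1) • (x + y) = (E x - (s + 1) • x) + (E y - (s + 1) • y) := by
        rw [map_add, smul_add]; abel
      rw [e]
      exact add_mem hx hy

/-- A smooth domain of finite type over an algebraically closed field of characteristic zero has
no proper non-zero ideal that is stable under all derivations. -/
theorem eq_bot_of_derivation_stable [IsAlgClosed K] [CharZero K] [IsDomain A]
    [Algebra.FiniteType K A] [Module.Projective A Ω[A⁄K]] (J : Ideal A) (hJ : J ≠ ⊤)
    (hD : ∀ D : Derivation K A A, ∀ a ∈ J, D a ∈ J) : J = ⊥ := by
  have : IsNoetherianRing A := Algebra.FiniteType.isNoetherianRing K A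
  obtain ⟨I, hI, hJI⟩ := Ideal.exists_le_maximal J hJ
  let := Ideal.Quotient.field I
  have := finite_of_finite_type_of_isJacobsonRing K (A ⧸ I)
  -- By the Nullstellensatz the maximal ideal is a K-point, where an Euler field is available.
  let e : K ≃ₐ[K] (A ⧸ I) := AlgEquiv.ofBijective (Algebra.ofId K (A ⧸ I))
    IsAlgClosed.algebraMap_bijective_of_isIntegral
  let p : A →ₐ[K] K := (e.symm : (A ⧸ I) →ₐ[K] K).comp (Ideal.Quotient.mkₐ K I)
  have hp : RingHom.ker p = I := by
    ext a
    simp [p, RingHom.mem_ker, Ideal.Quotient.eq_zero_iff_mem]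
  obtain ⟨E, h0, h1, h2⟩ := exists_euler_derivation p
  rw [hp] at h0 h1 h2
  have key : ∀ s, J ≤ I ^ s := by
    intro s
    induction s with
    | zero => simp
    | succ s ih =>
      -- For J ≤ Iˢ and a in J, both E a and E a − s a lie in Iˢ⁺¹, so s a does too. Dividing by s
      -- needs s ≠ 0; the step from 0 to 1 is the choice of I. Krull's intersection theorem
      -- finishes.
      rcases Nat.eq_zero_or_pos s with rfl | hs
      · simpa using hJI
      intro a ha
      have h3 := derivation_sub_smul_mem_pow E h0 h1 s a (ih ha)
      have h4 : E a ∈ I ^ (s + 1) := by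
        rw [pow_succ']
        exact Ideal.mul_mono_right ih (h2 J hD a ha)
      have h5 : (s : K) • a ∈ I ^ (s + 1) := by
        rw [Nat.cast_smul_eq_nsmul]
        simpa using sub_mem h4 h3
      have h6 : (s : K) ≠ 0 := by exact_mod_cast hs.ne'
      have h7 := Submodule.smul_of_tower_mem (I ^ (s + 1)) (s : K)⁻¹ h5
      rwa [inv_smul_smul₀ h6] at h7
  have h3 : J ≤ ⨅ s, I ^ s := le_iInf key
  rwa [Ideal.iInf_pow_eq_bot_of_isDomain I hI.ne_top, le_bot_iff] at h3

end DifferentialSimplicity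

/-! ### Burnside's theorem and commuting idempotents in irreducible Lie modules -/

section Density

variable {K L U : Type*} [Field K] [LieRing L] [LieAlgebra K L]
  [AddCommGroup U] [Module K U] [LieRingModule L U] [LieModule K L U]

/-- **Burnside's theorem** for an irreducible Lie module over an algebraically closed field. -/
theorem adjoin_range_toEnd_eq_top [IsAlgClosed K] [FiniteDimensional K U]
    [LieModule.IsIrreducible K L U] :
    Algebra.adjoin K (Set.range (LieModule.toEnd K L U)) = ⊤ := by
  set S := Algebra.adjoin K (Set.range (LieModule.toEnd K L U)) with hS
  have hmem : ∀ x : L, LieModule.toEnd K L U x ∈ S := fun x =>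
    Algebra.subset_adjoin ⟨x, rfl⟩
  have hnt : Nontrivial U := (LieSubmodule.nontrivial_iff K L U).1 inferInstance
  have hsimple : IsSimpleModule S U := by
    rw [isSimpleModule_iff]
    refine { exists_pair_ne := ⟨⊥, ⊤, bot_ne_top⟩, eq_bot_or_eq_top := fun W => ?_ }
    let W' : LieSubmodule K L U :=
      { W.restrictScalars K with lie_mem := fun {x w} hw => W.smul_mem ⟨_, hmem x⟩ hw }
    rcases eq_bot_or_eq_top W' with h | h
    · left
      rw [eq_bot_iff]
      intro w hw
      have : w ∈ W' := hw
      rw [h] at this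
      simpa using this
    · right
      rw [eq_top_iff]
      intro w _
      have : w ∈ W' := by rw [h]; trivial
      exact this
  rw [eq_top_iff]
  intro f _
  -- By Schur's lemma the commutant of S is K, so every K-linear f commutes with it; Jacobson
  -- density on a finite spanning set then places f in S.
  have hschur := (IsSimpleModule.algebraMap_end_bijective_of_isAlgClosed (A := S) (V := U) K).2
  let f' : Module.End (Module.End S U) U :=
    { f with
      map_smul' := fun c u => by
        obtain ⟨a, rfl⟩ := hschur c
        change f (a • u) = a • f u
        exact map_smul f a u }
  obtain ⟨s, hs⟩ := Module.Finite.fg_top (R := K) (M := U)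
  obtain ⟨r, hr⟩ := jacobson_density (R := S) f' s
  have : f = r := by
    apply LinearMap.ext_on hs
    intro u hu
    exact hr u hu
  rw [this]
  exact r.2

/-- A submodule of `R ⊗ U`, for a domain `R` and an irreducible Lie module `U`, that is stable
under the Lie algebra contains a submodule `a • (R ⊗ U)` with `a ≠ 0` if it is non-zero. -/
theorem exists_smul_mem_of_lie_stable [IsAlgClosed K] [FiniteDimensional K U]
    [LieModule.IsIrreducible K L U] {R : Type*} [CommRing R] [Algebra K R]
    (W : Submodule R (R ⊗[K] U)) (hW : W ≠ ⊥)
    (hL : ∀ (x : L), ∀ w ∈ W, (LieModule.toEnd K L U x).baseChange R w ∈ W) :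
    ∃ a : R, a ≠ 0 ∧ ∀ y : R ⊗[K] U, a • y ∈ W := by
  have hend : ∀ (f : Module.End K U), ∀ w ∈ W, f.baseChange R w ∈ W := by
    intro f
    have hf : f ∈ Algebra.adjoin K (Set.range (LieModule.toEnd K L U)) := by
      rw [adjoin_range_toEnd_eq_top]; trivial
    induction hf using Algebra.adjoin_induction with
    | mem f hf => obtain ⟨x, rfl⟩ := hf; exact hL x
    | algebraMap k =>
      intro w hw
      have : (algebraMap K (Module.End K U) k).baseChange R w = algebraMap K R k • w := by
        rw [Algebra.algebraMap_eq_smul_one, LinearMap.baseChange_smul, algebraMap_smul]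
        simp [Module.End.one_eq_id]
      rw [this]
      exact W.smul_mem _ hw
    | add f f' _ _ h h' =>
      intro w hw
      rw [LinearMap.baseChange_add]
      exact W.add_mem (h w hw) (h' w hw)
    | mul f f' _ _ h h' =>
      intro w hw
      have : (f * f').baseChange R w = f.baseChange R (f'.baseChange R w) := by
        rw [Module.End.mul_eq_comp, LinearMap.baseChange_comp]; rfl
      rw [this]
      exact h _ (h' w hw)
  obtain ⟨w, hw, hw0⟩ := W.exists_mem_ne_zero_of_ne_bot hW
  let b := Module.finBasis K U
  let bR := b.baseChange R
  have hne : bR.repr w ≠ 0 := by simpa using hw0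
  obtain ⟨j, hj⟩ := Finsupp.ne_iff.1 hne
  refine ⟨bR.repr w j, hj, fun y => ?_⟩
  have hstep : ∀ l, bR.repr w j • bR l ∈ W := by
    intro l
    -- A matrix unit moves the non-zero coordinate of w at j to an arbitrary basis vector.
    let f : Module.End K U := LinearMap.toSpanSingleton K U (b l) ∘ₗ b.coord j
    have : f.baseChange R w = bR.repr w j • bR l := by
      conv_lhs => rw [← bR.sum_repr w]
      rw [map_sum, Finset.sum_eq_single j]
      · simp [f, bR]
      · intro i _ hi
        simp [f, bR, hi]
      · simp
    rw [← this]
    exact hend f w hw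
  rw [← bR.sum_repr y, Finset.smul_sum]
  refine W.sum_mem fun l _ => ?_
  rw [smul_comm]
  exact W.smul_mem _ (hstep l)

/-- If operators in an irreducible Lie module are pairwise commuting idempotents and their sum
commutes with the Lie algebra, then the sum is a natural number. -/
theorem exists_sum_lie_eq_natCast_smul [LieModule.IsIrreducible K L U] {N : ℕ} (E : Fin N → L)
    (hcomm : ∀ i j, ⁅E i, E j⁆ = 0) (hidem : ∀ i (u : U), ⁅E i, ⁅E i, u⁆⁆ = ⁅E i, u⁆)
    (hcentral : ∀ x : L, ⁅x, ∑ i, E i⁆ = 0) :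
    ∃ k : ℕ, k ≤ N ∧ ∀ u : U, ∑ i, ⁅E i, u⁆ = (k : K) • u := by
  classical
  have hnt : Nontrivial U := (LieSubmodule.nontrivial_iff K L U).1 inferInstance
  -- A joint eigenvector, built one operator at a time: if Eⱼ does not kill u, replace u by Eⱼu,
  -- which Eⱼ fixes; commutation keeps the earlier eigenvalues. The set t records the indices with
  -- eigenvalue 1.
  have hjoint : ∀ s : Finset (Fin N), ∃ u : U, u ≠ 0 ∧ ∃ t : Finset (Fin N),
      ∀ i ∈ s, ⁅E i, u⁆ = if i ∈ t then u else 0 := by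
    intro s
    induction s using Finset.induction_on with
    | empty =>
      obtain ⟨u, hu⟩ := exists_ne (0 : U)
      exact ⟨u, hu, ∅, by simp⟩
    | insert j s hj ih =>
      obtain ⟨u, hu, t, ht⟩ := ih
      by_cases h0 : ⁅E j, u⁆ = 0
      · refine ⟨u, hu, t.erase j, fun i hi => ?_⟩
        rcases Finset.mem_insert.1 hi with rfl | hi
        · simp [h0]
        · have : i ≠ j := fun h => hj (h ▸ hi)
          simp [ht i hi, this]
      · refine ⟨⁅E j, u⁆, h0, insert j t, fun i hi => ?_⟩
        rcases Finset.mem_insert.1 hi with rfl | hi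
        · simp [hidem]
        · have : i ≠ j := fun h => hj (h ▸ hi)
          rw [leibniz_lie, hcomm, zero_lie, zero_add, ht i hi]
          simp only [Finset.mem_insert, this, false_or]
          split_ifs <;> simp
  obtain ⟨u, hu, t, ht⟩ := hjoint Finset.univ
  refine ⟨t.card, (Finset.card_le_univ t).trans_eq (Fintype.card_fin N), ?_⟩
  -- Because the sum is central, its eigenspace for the eigenvalue `t.card` is a Lie submodule.
  let W : LieSubmodule K L U :=
    { carrier := {w | ∑ i, ⁅E i, w⁆ = (t.card : K) • w}
      add_mem' := fun {a b} ha hb => by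
        rw [Set.mem_ofPred_eq] at *
        simp only [lie_add, Finset.sum_add_distrib, ha, hb, smul_add]
      zero_mem' := by simp
      smul_mem' := fun c a ha => by
        rw [Set.mem_ofPred_eq] at *
        simp only [lie_smul, ← Finset.smul_sum, ha]
        rw [smul_comm]
      lie_mem := fun {x w} hw => by
        change ∑ i, ⁅E i, ⁅x, w⁆⁆ = (t.card : K) • ⁅x, w⁆
        change ∑ i, ⁅E i, w⁆ = (t.card : K) • w at hw
        rw [← sum_lie] at hw ⊢
        rw [← lie_smul, ← hw, leibniz_lie x, hcentral x, zero_lie, zero_add] }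
  have hW : W ≠ ⊥ := by
    intro h
    have : u ∈ W := by
      change ∑ i, ⁅E i, u⁆ = (t.card : K) • u
      simp [ht, Finset.sum_ite_mem, Nat.cast_smul_eq_nsmul]
    rw [h] at this
    exact hu (by simpa using this)
  have hW' := (eq_bot_or_eq_top W).resolve_left hW
  intro w
  have : w ∈ W := by rw [hW']; trivial
  exact this

end Density

/-! ### Symbols and quadratic expressions in the action of vector fields -/

section AVModules

variable {K A M : Type*} [Field K] [CommRing A] [Algebra K A] [AddCommGroup M]
  [LieRingModule (Derivation K A A) M]

lemma derivation_lie_smul (ξ η : Derivation K A A) (f : A) :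
    ⁅ξ, f • η⁆ = ξ f • η + f • ⁅ξ, η⁆ := by
  ext a
  simp only [Derivation.commutator_apply, Derivation.smul_apply, Derivation.add_apply,
    smul_eq_mul, Derivation.leibniz]
  ring

/-- The quadratic expression `(fgη)·μ - (fη)·(gμ) - (gη)·(fμ) + η·(fgμ)` in the action of vector
fields. -/
def quadDiff (f g : A) (η μ : Derivation K A A) (x : M) : M :=
  ⁅(f * g) • η, ⁅μ, x⁆⁆ - ⁅f • η, ⁅g • μ, x⁆⁆ - ⁅g • η, ⁅f • μ, x⁆⁆ + ⁅η, ⁅(f * g) • μ, x⁆⁆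

/-- A vector field acts on `quadDiff` by differentiating each argument in turn. Hence the span of
its values on a V-submodule is V-stable. -/
lemma lie_quadDiff (ξ : Derivation K A A) (f g : A) (η μ : Derivation K A A) (x : M) :
    ⁅ξ, quadDiff f g η μ x⁆ = quadDiff f g η μ ⁅ξ, x⁆ + quadDiff (ξ f) g η μ x +
      quadDiff f (ξ g) η μ x + quadDiff f g ⁅ξ, η⁆ μ x + quadDiff f g η ⁅ξ, μ⁆ x := by
  have e : ξ (f * g) = ξ f * g + f * ξ g := by
    rw [Derivation.leibniz, smul_eq_mul, smul_eq_mul]; ring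
  simp only [quadDiff, lie_add, lie_sub, leibniz_lie ξ, derivation_lie_smul, e, add_smul, add_lie]
  abel

variable [Module A M]

/-- The failure `(fη)·x - f(η·x)` of the action of vector fields to be linear over functions. -/
def symbol (f : A) (η : Derivation K A A) (x : M) : M := ⁅f • η, x⁆ - f • ⁅η, x⁆

lemma smul_lie_eq_symbol_add (f : A) (η : Derivation K A A) (x : M) :
    ⁅f • η, x⁆ = symbol f η x + f • ⁅η, x⁆ := by
  rw [symbol, sub_add_cancel]

lemma symbol_add (f : A) (η : Derivation K A A) (x y : M) :
    symbol f η (x + y) = symbol f η x + symbol f η y := by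
  simp only [symbol, lie_add, smul_add]
  abel

/-- The derivative terms (fη)(a) x and f η(a) x cancel. -/
lemma symbol_smul
    (hleib : ∀ (η : Derivation K A A) (f : A) (x : M), ⁅η, f • x⁆ = η f • x + f • ⁅η, x⁆)
    (f a : A) (η : Derivation K A A) (x : M) : symbol f η (a • x) = a • symbol f η x := by
  simp only [symbol, hleib, Derivation.smul_apply, smul_eq_mul]
  module

/-- With linearity in η, the symbol is a derivation in f: it splits as the failure for f applied to
gη plus f times the failure for g applied to η. -/
lemma symbol_mul
    (hsymb : ∀ (f a : A) (η : Derivation K A A) (x : M), symbol f (a • η) x = a • symbol f η x)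
    (f g : A) (η : Derivation K A A) (x : M) :
    symbol (f * g) η x = f • symbol g η x + g • symbol f η x := by
  rw [← hsymb f g]
  simp only [symbol, mul_smul, smul_sub]
  abel

/-- If the symbol is linear over functions in the vector field, then the second order parts
of `quadDiff` cancel. -/
lemma quadDiff_eq
    (hleib : ∀ (η : Derivation K A A) (f : A) (x : M), ⁅η, f • x⁆ = η f • x + f • ⁅η, x⁆)
    (hsymb : ∀ (f a : A) (η : Derivation K A A) (x : M), symbol f (a • η) x = a • symbol f η x)
    (f g : A) (η μ : Derivation K A A) (x : M) :
    quadDiff f g η μ x = η f • symbol g μ x + η g • symbol f μ x -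
      symbol f η (symbol g μ x) - symbol g η (symbol f μ x) := by
  have e : η (f * g) = f * η g + g * η f := by
    rw [Derivation.leibniz, smul_eq_mul, smul_eq_mul]
  simp only [quadDiff, smul_lie_eq_symbol_add _ μ, symbol_mul hsymb, lie_add, hleib,
    smul_lie_eq_symbol_add _ η, symbol_add, symbol_smul hleib, e]
  module

/-- In the closed formula of `quadDiff_eq` every term is linear over functions in η. The gain is
that the right side involves only vector fields, so multiples by functions do not leave a
V-submodule. -/
lemma smul_quadDiff
    (hleib : ∀ (η : Derivation K A A) (f : A) (x : M), ⁅η, f • x⁆ = η f • x + f • ⁅η, x⁆)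
    (hsymb : ∀ (f a : A) (η : Derivation K A A) (x : M), symbol f (a • η) x = a • symbol f η x)
    (a f g : A) (η μ : Derivation K A A) (x : M) :
    a • quadDiff f g η μ x = quadDiff f g (a • η) μ x := by
  simp only [quadDiff_eq hleib hsymb, hsymb, Derivation.smul_apply, smul_eq_mul]
  module

/-- In an `AV`-module that is simple as an `AV`-module and whose symbol is linear over functions,
the existence of a proper non-zero `V`-submodule forces the operators `quadDiff` to vanish. -/
theorem quadDiff_eq_zero [Module K M]
    (hleib : ∀ (η : Derivation K A A) (f : A) (x : M), ⁅η, f • x⁆ = η f • x + f • ⁅η, x⁆)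
    (hsymb : ∀ (f a : A) (η : Derivation K A A) (x : M), symbol f (a • η) x = a • symbol f η x)
    (hsimple : ∀ W : Submodule A M, (∀ (η : Derivation K A A), ∀ x ∈ W, ⁅η, x⁆ ∈ W) →
      W ≠ ⊥ → W = ⊤)
    (M' : LieSubmodule K (Derivation K A A) M) (hbot : M' ≠ ⊥) (htop : M' ≠ ⊤)
    (f g : A) (η μ : Derivation K A A) (x : M) : quadDiff f g η μ x = 0 := by
  have hstable : ∀ s : Set M, (∀ (ξ : Derivation K A A), ∀ x ∈ s, ⁅ξ, x⁆ ∈ Submodule.span A s) →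
      ∀ (ξ : Derivation K A A), ∀ x ∈ Submodule.span A s, ⁅ξ, x⁆ ∈ Submodule.span A s := by
    intro s hs ξ x hx
    induction hx using Submodule.span_induction with
    | mem x hx => exact hs ξ x hx
    | zero => simp
    | add x y _ _ hx hy => rw [lie_add]; exact add_mem hx hy
    | smul a x hx' hx =>
      rw [hleib]
      exact add_mem (Submodule.smul_mem _ _ hx') (Submodule.smul_mem _ _ hx)
  let T : Set M := {y | ∃ f g η μ, ∃ x ∈ M', y = quadDiff (K := K) (A := A) f g η μ x}
  have hTmem : ∀ (f g : A) (η μ : Derivation K A A), ∀ x ∈ M',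
      quadDiff f g η μ x ∈ Submodule.span A T :=
    fun f g η μ x hx => Submodule.subset_span ⟨f, g, η, μ, x, hx, rfl⟩
  have hTM' : ∀ y ∈ Submodule.span A T, ∀ a : A, a • y ∈ M' := by
    intro y hy
    induction hy using Submodule.span_induction with
    | mem y hy =>
      obtain ⟨f, g, η, μ, x, hx, rfl⟩ := hy
      intro a
      rw [smul_quadDiff hleib hsymb]
      have hl : ∀ (ξ : Derivation K A A), ∀ x ∈ M', ⁅ξ, x⁆ ∈ M' := fun ξ x hx => M'.lie_mem hx
      exact add_mem (sub_mem (sub_mem (hl _ _ (hl _ _ hx)) (hl _ _ (hl _ _ hx)))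
        (hl _ _ (hl _ _ hx))) (hl _ _ (hl _ _ hx))
    | zero => intro a; rw [smul_zero]; exact zero_mem _
    | add x y _ _ hx hy => intro a; rw [smul_add]; exact add_mem (hx a) (hy a)
    | smul b x _ hx => intro a; rw [← mul_smul]; exact hx _
  -- Otherwise simplicity makes this span all of M, although it is contained in the proper submodule
  -- M'.
  have hT : Submodule.span A T = ⊥ := by
    by_contra h
    have h1 := hsimple _ (hstable T (by
      rintro ξ _ ⟨f, g, η, μ, x, hx, rfl⟩
      rw [lie_quadDiff]
      exact add_mem (add_mem (add_mem (add_mem (hTmem _ _ _ _ _ (M'.lie_mem hx))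
        (hTmem _ _ _ _ _ hx)) (hTmem _ _ _ _ _ hx)) (hTmem _ _ _ _ _ hx))
        (hTmem _ _ _ _ _ hx))) h
    apply htop
    rw [eq_top_iff]
    intro y _
    have := hTM' y (by rw [h1]; trivial) 1
    rwa [one_smul] at this
  have hspan : Submodule.span A (M' : Set M) = ⊤ := by
    refine hsimple _ (hstable _ fun ξ x hx => Submodule.subset_span (M'.lie_mem hx)) fun h => hbot ?_
    rw [eq_bot_iff]
    intro x hx
    have : x ∈ Submodule.span A (M' : Set M) := Submodule.subset_span hx
    rw [h] at this
    simpa using this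
  have hx : x ∈ Submodule.span A (M' : Set M) := by rw [hspan]; trivial
  induction hx using Submodule.span_induction with
  | mem x hx =>
    have := hTmem f g η μ x hx
    rwa [hT, Submodule.mem_bot] at this
  | zero => simp [quadDiff]
  | add x y _ _ hx hy =>
    have : quadDiff f g η μ (x + y) = quadDiff f g η μ x + quadDiff f g η μ y := by
      simp only [quadDiff, lie_add]
      abel
    rw [this, hx, hy, add_zero]
  | smul a x _ hx =>
    have : quadDiff f g η μ (a • x) = a • quadDiff f g η μ x := by
      simp only [quadDiff_eq hleib hsymb, symbol_smul hleib]
      module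
    rw [this, hx, smul_zero]

/-- A stable submodule that contains a non-zero multiple of the whole module is everything, if
the functions have no proper stable ideals. -/
lemma eq_top_of_smul_mem
    (hleib : ∀ (η : Derivation K A A) (f : A) (x : M), ⁅η, f • x⁆ = η f • x + f • ⁅η, x⁆)
    (hA : ∀ J : Ideal A, J ≠ ⊤ → (∀ D : Derivation K A A, ∀ a ∈ J, D a ∈ J) → J = ⊥)
    (W : Submodule A M) (hW : ∀ (η : Derivation K A A), ∀ x ∈ W, ⁅η, x⁆ ∈ W) {a : A} (ha : a ≠ 0)
    (h : ∀ x, a • x ∈ W) : W = ⊤ := by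
  let J : Ideal A :=
    { carrier := {a | ∀ x, a • x ∈ W}
      add_mem' := fun {a b} ha hb x => by rw [add_smul]; exact add_mem (ha x) (hb x)
      zero_mem' := fun x => by rw [zero_smul]; exact zero_mem _
      smul_mem' := fun b a ha x => by rw [smul_assoc]; exact W.smul_mem _ (ha x) }
  have hJ : J = ⊤ := by
    by_contra hne
    -- The multiplier ideal is derivation-stable because D(b) x = D·(b x) − b (D·x).
    have h0 := hA J hne fun D b hb x => by
      have h1 := hleib D b x
      rw [← sub_eq_iff_eq_add] at h1
      rw [← h1]
      exact sub_mem (hW D _ (hb x)) (hb _)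
    have : a ∈ J := h
    rw [h0] at this
    exact ha (by simpa using this)
  rw [eq_top_iff]
  intro x _
  have : (1 : A) ∈ J := by rw [hJ]; trivial
  simpa using this x

end AVModules

/-! ### Non-zero minors of maximal size -/

section Minors

/-- A finite family of vectors has an increasing subfamily that is a basis of its span. -/
lemma exists_orderEmbedding_linearIndependent {F V : Type*} [Field F] [AddCommGroup V]
    [Module F V] {m : ℕ} (v : Fin m → V) {r : ℕ}
    (hr : Module.finrank F (Submodule.span F (Set.range v)) = r) :
    ∃ f : Fin r ↪o Fin m, LinearIndependent F (v ∘ f) := by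
  classical
  obtain ⟨κ, a, ha, hspan, hli⟩ := exists_linearIndependent' F v
  have : Finite κ := Finite.of_injective a ha
  have := Fintype.ofFinite κ
  have hcard : (Finset.univ.map ⟨a, ha⟩).card = r := by
    rw [Finset.card_map, Finset.card_univ, ← hr, ← hspan, finrank_span_eq_card hli]
  refine ⟨(Finset.univ.map ⟨a, ha⟩).orderEmbOfFin hcard, ?_⟩
  have hmem : ∀ i, ∃ k, a k = (Finset.univ.map ⟨a, ha⟩).orderEmbOfFin hcard i := fun i => by
    obtain ⟨k, -, hk⟩ := Finset.mem_map.1 (Finset.orderEmbOfFin_mem _ hcard i)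
    exact ⟨k, hk⟩
  choose σ hσ using hmem
  have hσi : Function.Injective σ := fun i j h =>
    (Finset.orderEmbOfFin _ hcard).injective (by rw [← hσ, ← hσ, h])
  have h := hli.comp σ hσi
  convert h using 1
  funext i
  simp [hσ]

/-- A matrix of rank `r` over a field has a non-zero minor of size `r`. -/
lemma exists_minor_ne_zero {F : Type*} [Field F] {m n : ℕ} (M : Matrix (Fin m) (Fin n) F) :
    ∃ (rows : Fin M.rank ↪o Fin m) (cols : Fin M.rank ↪o Fin n),
      (M.submatrix rows cols).det ≠ 0 := by
  obtain ⟨rows, hrows⟩ := exists_orderEmbedding_linearIndependent M.row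
    M.rank_eq_finrank_span_row.symm
  let M₁ := M.submatrix rows id
  have h1 : M₁.rank = M.rank := by
    have : LinearIndependent F M₁.row := hrows
    rw [this.rank_matrix, Fintype.card_fin]
  obtain ⟨cols, hcols⟩ := exists_orderEmbedding_linearIndependent M₁.col
    (M₁.rank_eq_finrank_span_cols.symm.trans h1)
  refine ⟨rows, cols, ?_⟩
  have h2 : LinearIndependent F (M.submatrix rows cols).col := hcols
  rw [Matrix.linearIndependent_cols_iff_isUnit, Matrix.isUnit_iff_isUnit_det] at h2
  exact h2.ne_zero

end Minors

universe u v w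

/-! ### Existence of charts and of enough polynomial vector fields -/

section Atlas

variable {K : Type u} [Field K] {n m : ℕ} {g : Fin m → MvPolynomial (Fin n) K}
  [(Ideal.span (Set.range g)).IsPrime]

variable (g) in
/-- The standard atlas is not empty. -/
lemma nonempty_chart : Nonempty (Chart g) := by
  obtain ⟨rows, cols, h⟩ := exists_minor_ne_zero
    ((jacobian g).map (algebraMap (CoordRing g) (FractionRing (CoordRing g))))
  refine ⟨⟨rows, cols, fun h0 => h ?_⟩⟩
  have h1 := RingHom.map_det (algebraMap (CoordRing g) (FractionRing (CoordRing g)))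
    ((jacobian g).submatrix rows cols)
  exact h1.symm.trans ((congrArg _ h0).trans (map_zero _))

namespace Chart

variable (c : Chart g)

lemma powers_minor_le : Submonoid.powers c.minor ≤ nonZeroDivisors (CoordRing g) :=
  powers_le_nonZeroDivisors_of_noZeroDivisors c.det_ne_zero

instance isDomain_locRing : IsDomain c.LocRing :=
  IsLocalization.isDomain_localization c.powers_minor_le

lemma algebraMap_locRing_injective :
    Function.Injective (algebraMap (CoordRing g) c.LocRing) :=
  IsLocalization.injective _ c.powers_minor_le

/-- A multiple of `∂/∂tᵢ` by a power of `h` is a polynomial vector field. -/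
lemma exists_vectorField (i : Fin (dim g)) :
    ∃ s ∈ Submonoid.powers c.minor, ∃ η : VectorField g, ∀ j,
      η (c.param j) = if j = i then s else 0 := by
  -- s is a common denominator of the finitely many functions ∂xₖ/∂tᵢ.
  obtain ⟨s, hs⟩ := IsLocalization.exist_integer_multiples_of_finite (Submonoid.powers c.minor)
    fun k => c.partialDeriv i (algebraMap (CoordRing g) c.LocRing (coord g k))
  choose b hb' using hs
  have hb : ∀ k, algebraMap (CoordRing g) c.LocRing (b k) = algebraMap _ _ (s : CoordRing g) *
      c.partialDeriv i (algebraMap (CoordRing g) c.LocRing (coord g k)) :=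
    fun k => (hb' k).trans (Algebra.smul_def _ _)
  -- A is its own localization at 1, so `exists_derivation` also produces derivations of A.
  have : IsLocalization.Away (1 : CoordRing g) (CoordRing g) :=
    IsLocalization.away_of_isUnit_of_bijective _ isUnit_one Function.bijective_id
  obtain ⟨D, hD⟩ := exists_derivation (R := CoordRing g) g 1 b (fun l => by
    apply c.algebraMap_locRing_injective
    rw [map_sum, map_zero, ← mul_zero (algebraMap (CoordRing g) c.LocRing s),
      ← sum_jacobian_mul_derivation g (c.partialDeriv i) l, Finset.mul_sum]
    refine Finset.sum_congr rfl fun k _ => ?_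
    rw [map_mul, hb]
    exact mul_left_comm _ _ _)
  refine ⟨s, s.2, D, fun j => ?_⟩
  apply c.algebraMap_locRing_injective
  have h1 : D (c.param j) = b (c.paramIndex j) := hD _
  have h2 := c.partialDeriv_param i j
  rw [param] at h2
  rw [h1, hb, h2]
  split_ifs
  · rw [mul_one]
  · rw [mul_zero, map_zero]

end Chart

end Atlas

/-! ### Stable submodules of the local model -/

section Gauge

variable {K : Type u} [Field K] {n m : ℕ} {g : Fin m → MvPolynomial (Fin n) K}
  [(Ideal.span (Set.range g)).IsPrime] {c : Chart g}
  {U : Type v} [AddCommGroup U] [Module K U] [LieRingModule (Gl g) U] [LieModule K (Gl g) U]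

omit [(Ideal.span (Set.range g)).IsPrime] [LieRingModule (Gl g) U] [LieModule K (Gl g) U] in
lemma coordRing_smul_eq (a : CoordRing g) (x : c.LocTensor U) :
    a • x = algebraMap (CoordRing g) c.LocRing a • x :=
  (algebraMap_smul c.LocRing a x).symm

/-- The symbol of the action on `A_(h) ⊗ U` is given by `df ⊗ η ↦ ∑ ∂f/∂tₚ η(tᵢ) ρ(Eₚᵢ)`. -/
lemma vectorFieldAction_smul (B : c.GaugeFields U) (f : CoordRing g)
    (η : VectorField g) (x : c.LocTensor U) :
    B.vectorFieldAction (f • η) x = f • B.vectorFieldAction η x +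
      ∑ i, ∑ p, (algebraMap (CoordRing g) c.LocRing (η (c.param i)) *
        c.partialDeriv p (algebraMap (CoordRing g) c.LocRing f)) •
        (LieModule.toEnd K (Gl g) U (Matrix.single p i 1)).baseChange c.LocRing x := by
  rw [coordRing_smul_eq]
  simp only [Chart.GaugeFields.vectorFieldAction, Chart.GaugeFields.action,
    Derivation.smul_apply, smul_eq_mul, map_mul, Derivation.leibniz, Finset.smul_sum,
    ← Finset.sum_add_distrib]
  refine Finset.sum_congr rfl fun i _ => ?_
  rw [smul_add, add_assoc, Finset.smul_sum, ← Finset.sum_add_distrib, mul_smul]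
  congr 1
  refine Finset.sum_congr rfl fun p _ => ?_
  rw [add_smul, mul_smul]

/-- If every element of a finitely generated module over a domain has a non-zero multiple in `W`,
there is a common multiplier. -/
lemma exists_smul_mem_of_fg {A P : Type*} [CommRing A] [IsDomain A] [AddCommGroup P] [Module A P]
    {L W : Submodule A P} (hL : L.FG) (h : ∀ y ∈ L, ∃ a : A, a ≠ 0 ∧ a • y ∈ W) :
    ∃ a : A, a ≠ 0 ∧ ∀ y ∈ L, a • y ∈ W := by
  classical
  induction L, hL using Submodule.fg_induction with
  | singleton x =>
    obtain ⟨a, ha, hx⟩ := h x (Submodule.mem_span_singleton_self x)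
    refine ⟨a, ha, fun y hy => ?_⟩
    obtain ⟨b, rfl⟩ := Submodule.mem_span_singleton.1 hy
    rw [smul_comm]
    exact W.smul_mem b hx
  | sup L₁ L₂ _ _ h₁ h₂ =>
    obtain ⟨a₁, ha₁, h₁⟩ := h₁ fun y hy => h y (Submodule.mem_sup_left hy)
    obtain ⟨a₂, ha₂, h₂⟩ := h₂ fun y hy => h y (Submodule.mem_sup_right hy)
    refine ⟨a₁ * a₂, mul_ne_zero ha₁ ha₂, fun y hy => ?_⟩
    obtain ⟨y₁, hy₁, y₂, hy₂, rfl⟩ := Submodule.mem_sup.1 hy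
    rw [smul_add]
    refine add_mem ?_ ?_
    · rw [mul_comm, mul_smul]
      exact W.smul_mem _ (h₁ _ hy₁)
    · rw [mul_smul]
      exact W.smul_mem _ (h₂ _ hy₂)

/-- Every element of the span over a localization of a submodule has a non-zero multiple in it. -/
lemma exists_smul_mem_of_mem_span {A P R : Type*} [CommRing A] [IsDomain A] [AddCommGroup P]
    [Module A P] {S : Submonoid A} (hS : S ≤ nonZeroDivisors A) [CommRing R] [Algebra A R]
    [IsLocalization S R] [Module R P] [IsScalarTower A R P] (W : Submodule A P) {y : P}
    (hy : y ∈ Submodule.span R (W : Set P)) : ∃ b : A, b ≠ 0 ∧ b • y ∈ W := by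
  induction hy using Submodule.span_induction with
  | mem x hx => exact ⟨1, one_ne_zero, by rwa [one_smul]⟩
  | zero => exact ⟨1, one_ne_zero, by rw [smul_zero]; exact zero_mem _⟩
  | add x y _ _ hx hy =>
    obtain ⟨a, ha, hx⟩ := hx
    obtain ⟨b, hb, hy⟩ := hy
    refine ⟨a * b, mul_ne_zero ha hb, ?_⟩
    rw [smul_add]
    refine add_mem ?_ ?_
    · rw [mul_comm, mul_smul]
      exact W.smul_mem _ hx
    · rw [mul_smul]
      exact W.smul_mem _ hy
  | smul r x _ hx =>
    obtain ⟨b, hb, hx⟩ := hx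
    obtain ⟨⟨a, s⟩, hs⟩ := IsLocalization.surj S r
    refine ⟨s * b, mul_ne_zero (nonZeroDivisors.ne_zero (hS s.2)) hb, ?_⟩
    have h1 : ((s : A) * b) • r • x = a • b • x := by
      rw [mul_comm, ← algebraMap_smul R, ← algebraMap_smul R a, ← algebraMap_smul R b, ← hs,
        map_mul]
      module
    rw [h1]
    exact W.smul_mem _ hx

/-- A non-zero `A`-submodule of `A_(h) ⊗ U` that is stable under the vector fields spans, over
`A_(h)`, a submodule that contains a non-zero multiple of `A_(h) ⊗ U`. -/
lemma exists_smul_mem_span_of_stable [IsAlgClosed K] [FiniteDimensional K U]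
    [LieModule.IsIrreducible K (Gl g) U] (B : c.GaugeFields U)
    (W : Submodule (CoordRing g) (c.LocTensor U)) (hW : W ≠ ⊥)
    (hstable : ∀ (η : VectorField g), ∀ x ∈ W, B.vectorFieldAction η x ∈ W) :
    ∃ a : c.LocRing, a ≠ 0 ∧ ∀ y : c.LocTensor U,
      a • y ∈ Submodule.span c.LocRing (W : Set (c.LocTensor U)) := by
  classical
  have hsingle : ∀ p i, ∀ w ∈ W, (LieModule.toEnd K (Gl g) U (Matrix.single p i 1)).baseChange
      c.LocRing w ∈ Submodule.span c.LocRing (W : Set (c.LocTensor U)) := by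
    intro p i w hw
    obtain ⟨s, hs, η, hη⟩ := c.exists_vectorField i
    -- With f = tₚ and η = s ∂/∂tᵢ the double sum reduces to s ρ(Eₚᵢ)w, and s is a unit of the
    -- localization.
    have h1 := vectorFieldAction_smul B (c.param p) η w
    rw [Finset.sum_eq_single i, Finset.sum_eq_single p] at h1
    · rw [c.partialDeriv_param, if_pos rfl, mul_one, hη, if_pos rfl, ← sub_eq_iff_eq_add'] at h1
      have h2 := sub_mem (hstable (c.param p • η) w hw)
        (W.smul_mem (c.param p) (hstable η w hw))
      rw [h1] at h2
      have hu : IsUnit (algebraMap (CoordRing g) c.LocRing s) :=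
        IsLocalization.map_units c.LocRing (⟨s, hs⟩ : Submonoid.powers c.minor)
      exact (Submodule.smul_mem_iff_of_isUnit _ hu).1 (Submodule.subset_span h2)
    · intro q _ hq
      rw [c.partialDeriv_param, if_neg (Ne.symm hq), mul_zero, zero_smul]
    · simp
    · intro j _ hj
      refine Finset.sum_eq_zero fun q _ => ?_
      rw [hη, if_neg hj, map_zero, zero_mul, zero_smul]
    · simp
  refine exists_smul_mem_of_lie_stable (L := Gl g) _ (fun h => hW ?_) ?_
  · rw [eq_bot_iff]
    intro x hx
    have : x ∈ Submodule.span c.LocRing (W : Set (c.LocTensor U)) := Submodule.subset_span hx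
    rw [h] at this
    simpa using this
  · intro x w hw
    induction hw using Submodule.span_induction with
    | mem w hw =>
      -- The base-changed action is K-linear in the matrix, so matrix units suffice.
      let φ : Gl g →ₗ[K] c.LocTensor U →ₗ[c.LocRing] c.LocTensor U :=
        LinearMap.baseChangeHom K c.LocRing U U ∘ₗ (LieModule.toEnd K (Gl g) U : Gl g →ₗ[K] _)
      change φ x w ∈ _
      have hx : φ x w = ∑ p, ∑ i, x p i • φ (Matrix.single p i 1) w := by
        conv_lhs => rw [Matrix.matrix_eq_sum_single x]
        have h1 : ∀ p i, Matrix.single p i (x p i) = x p i • (Matrix.single p i 1 : Gl g) :=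
          fun p i => by rw [Matrix.smul_single, smul_eq_mul, mul_one]
        simp only [h1, map_sum, map_smul, LinearMap.sum_apply, LinearMap.smul_apply]
      rw [hx]
      exact sum_mem fun p _ => sum_mem fun i _ =>
        Submodule.smul_of_tower_mem _ _ (hsingle p i w hw)
    | zero => rw [map_zero]; exact zero_mem _
    | add y z _ _ hy hz => rw [map_add]; exact add_mem hy hz
    | smul r y _ hy => rw [map_smul]; exact Submodule.smul_mem _ _ hy

end Gauge

/-! ### Symbols in the chart, and simplicity over AV -/

section LocalModel

variable {K : Type u} [Field K] {n m : ℕ} {g : Fin m → MvPolynomial (Fin n) K}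
  [(Ideal.span (Set.range g)).IsPrime] {c : Chart g}
  {U : Type v} [AddCommGroup U] [Module K U] [LieRingModule (Gl g) U] [LieModule K (Gl g) U]
  {M : Type w} [AddCommGroup M] [Module (CoordRing g) M] [LieRingModule (VectorField g) M]
  {B : c.GaugeFields U} {L : Submodule (CoordRing g) (c.LocTensor U)}
  (e : M ≃ₗ[CoordRing g] L)
  (he : ∀ (η : VectorField g) (x : M), (e ⁅η, x⁆ : c.LocTensor U) = B.vectorFieldAction η (e x))

include he

/-- The terms with ∂/∂tᵢ + Bᵢ are linear in the coefficients of the vector field and drop out, so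
the gauge fields leave no trace. -/
lemma coe_symbol (f : CoordRing g) (η : VectorField g) (x : M) :
    (e (symbol f η x) : c.LocTensor U) =
      ∑ i, ∑ p, (algebraMap (CoordRing g) c.LocRing (η (c.param i)) *
        c.partialDeriv p (algebraMap (CoordRing g) c.LocRing f)) •
        (LieModule.toEnd K (Gl g) U (Matrix.single p i 1)).baseChange c.LocRing (e x) := by
  rw [symbol, map_sub, map_smul, Submodule.coe_sub, Submodule.coe_smul, he, he,
    vectorFieldAction_smul, add_sub_cancel_left]

/-- In the chart formula η enters only through the functions η(tᵢ). This provides the linearity that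
the study of `quadDiff` takes as a hypothesis. -/
lemma symbol_smul_vectorField (f a : CoordRing g) (η : VectorField g) (x : M) :
    symbol f (a • η) x = a • symbol f η x := by
  apply e.injective
  apply Subtype.ext
  rw [map_smul, Submodule.coe_smul, coordRing_smul_eq, coe_symbol e he, coe_symbol e he]
  simp only [Finset.smul_sum, Derivation.smul_apply, smul_eq_mul, map_mul, mul_assoc]
  simp only [mul_smul]

lemma coe_symbol_param {i : Fin (dim g)} {s : CoordRing g} {η : VectorField g}
    (hη : ∀ j, η (c.param j) = if j = i then s else 0) (p : Fin (dim g)) (x : M) :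
    (e (symbol (c.param p) η x) : c.LocTensor U) = algebraMap (CoordRing g) c.LocRing s •
      (LieModule.toEnd K (Gl g) U (Matrix.single p i 1)).baseChange c.LocRing (e x) := by
  rw [coe_symbol e he, Finset.sum_eq_single i, Finset.sum_eq_single p]
  · rw [c.partialDeriv_param, if_pos rfl, mul_one, hη, if_pos rfl]
  · intro q _ hq
    rw [c.partialDeriv_param, if_neg (Ne.symm hq), mul_zero, zero_smul]
  · simp
  · intro j _ hj
    refine Finset.sum_eq_zero fun q _ => ?_
    rw [hη, if_neg hj, map_zero, zero_mul, zero_smul]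
  · simp

lemma exists_smul_mem_span_map_of_stable [IsAlgClosed K] [FiniteDimensional K U]
    [LieModule.IsIrreducible K (Gl g) U] (W : Submodule (CoordRing g) M) (hW : W ≠ ⊥)
    (hstable : ∀ (η : VectorField g), ∀ x ∈ W, ⁅η, x⁆ ∈ W) :
    ∃ a : c.LocRing, a ≠ 0 ∧ ∀ y : c.LocTensor U,
      a • y ∈ Submodule.span c.LocRing ((fun x : M => (e x : c.LocTensor U)) '' W) := by
  refine exists_smul_mem_span_of_stable B (W.map (L.subtype ∘ₗ e.toLinearMap)) (fun h => hW ?_) ?_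
  · refine Submodule.map_injective_of_injective (f := L.subtype ∘ₗ e.toLinearMap)
      (L.injective_subtype.comp e.injective) ?_
    rw [h, Submodule.map_bot]
  · rintro η _ ⟨x, hx, rfl⟩
    exact ⟨⁅η, x⁆, hstable η x hx, he η x⟩

/-- A gauge module for a simple `gl_N`-module is simple as an `AV`-module. -/
theorem eq_top_of_stable [IsAlgClosed K] [CharZero K] [Algebra.Smooth K (CoordRing g)]
    [FiniteDimensional K U] [LieModule.IsIrreducible K (Gl g) U] [IsAVModule g M] (hL : L.FG)
    (W : Submodule (CoordRing g) M) (hstable : ∀ (η : VectorField g), ∀ x ∈ W, ⁅η, x⁆ ∈ W)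
    (hW : W ≠ ⊥) : W = ⊤ := by
  obtain ⟨a, ha, hspan⟩ := exists_smul_mem_span_map_of_stable e he W hW hstable
  obtain ⟨⟨a', s⟩, hs⟩ := IsLocalization.surj (Submonoid.powers c.minor) a
  have ha' : a' ≠ 0 := by
    rintro rfl
    rw [map_zero] at hs
    exact ha (((IsLocalization.map_units c.LocRing s).mul_left_eq_zero).1 hs)
  let W' := W.map (L.subtype ∘ₗ e.toLinearMap)
  -- Each element of L has its own denominator; finite generation of L gives a single b with bM
  -- inside W.
  obtain ⟨b, hb, hbL⟩ := exists_smul_mem_of_fg (W := W') hL fun y hy => by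
    have h1 : a' • y ∈ Submodule.span c.LocRing (W' : Set (c.LocTensor U)) := by
      rw [coordRing_smul_eq, ← hs, mul_comm, mul_smul]
      exact Submodule.smul_mem _ _ (hspan y)
    obtain ⟨b, hb, h2⟩ := exists_smul_mem_of_mem_span c.powers_minor_le W' h1
    exact ⟨b * a', mul_ne_zero hb ha', by simpa only [mul_smul] using h2⟩
  refine eq_top_of_smul_mem (K := K) IsAVModule.leibniz
    (fun J hJ hD => eq_bot_of_derivation_stable J hJ hD) W hstable hb fun x => ?_
  obtain ⟨w, hw, hwx⟩ := hbL (e x) (e x).2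
  have : w = b • x := by
    apply e.injective
    apply Subtype.ext
    rw [map_smul]
    exact hwx
  rwa [← this]

end LocalModel

/-- A vector of the base that is annihilated by a non-zero scalar is zero. -/
lemma eq_zero_of_tmul_eq_zero {K R U : Type*} [Field K] [CommRing R] [IsDomain R] [Algebra K R]
    [AddCommGroup U] [Module K U] {a : R} (ha : a ≠ 0) {u : U} (h : a ⊗ₜ[K] u = 0) : u = 0 := by
  let b := Module.Free.chooseBasis K U
  rw [← b.repr.map_eq_zero_iff]
  ext i
  have h1 := congrArg (fun z => (b.baseChange R).repr z i) h
  simpa [ha] using h1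

end GaugeModules

/-! ### The main theorem -/

open GaugeModules in
theorem lemma6 {K : Type*} [Field K] [IsAlgClosed K] [CharZero K] {n m : ℕ}
    (g : Fin m → MvPolynomial (Fin n) K) [(Ideal.span (Set.range g)).IsPrime]
    [Algebra.Smooth K (GaugeModules.CoordRing g)]
    (U : Type*) [AddCommGroup U] [Module K U] [FiniteDimensional K U]
    [LieRingModule (GaugeModules.Gl g) U] [LieModule K (GaugeModules.Gl g) U]
    [LieModule.IsIrreducible K (GaugeModules.Gl g) U]
    (M : Type*) [AddCommGroup M] [Module K M] [Module (GaugeModules.CoordRing g) M]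
    [IsScalarTower K (GaugeModules.CoordRing g) M]
    [LieRingModule (GaugeModules.VectorField g) M] [LieModule K (GaugeModules.VectorField g) M]
    [GaugeModules.IsAVModule g M]
    (hM : GaugeModules.IsGaugeModule g U M) (hred : GaugeModules.IsReducible g M) :
    ∃ k : ℕ, k ≤ GaugeModules.dim g ∧
      ∀ x : U, ∑ i, ⁅(Matrix.single i i 1 : GaugeModules.Gl g), x⁆ = (k : K) • x := by
  obtain ⟨c⟩ := nonempty_chart g
  obtain ⟨B, L, hL, -, e, he⟩ := hM c
  obtain ⟨M', hbot, htop⟩ := hred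
  have hleib : ∀ (η : VectorField g) (f : CoordRing g) (x : M),
      ⁅η, f • x⁆ = η f • x + f • ⁅η, x⁆ := IsAVModule.leibniz
  have hsymb := symbol_smul_vectorField (M := M) e he
  have hquad := quadDiff_eq_zero hleib hsymb (eq_top_of_stable e he hL) M' hbot htop
  have hloc : ∀ (i : Fin (dim g)) (x : M),
      let E := (LieModule.toEnd K (Gl g) U (Matrix.single i i 1)).baseChange c.LocRing
      E (E (e x)) = E (e x) := by
    intro i x E
    obtain ⟨s, hs, η, hη⟩ := c.exists_vectorField i
    -- For these arguments `quadDiff` equals 2(sσ − σ²), where σ is the symbol of tᵢ and η = s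
    -- ∂/∂tᵢ. In the chart σ is s ρ(Eᵢᵢ); cancelling 2 and the unit s twice leaves idempotency.
    have h1 := hquad (c.param i) (c.param i) η η x
    rw [quadDiff_eq hleib hsymb, hη, if_pos rfl] at h1
    have h2 : (2 : K) • (s • symbol (c.param i) η x -
        symbol (c.param i) η (symbol (c.param i) η x)) = 0 := by
      rw [← h1, two_smul]
      abel
    have h3 := sub_eq_zero.1 ((smul_eq_zero.1 h2).resolve_left two_ne_zero)
    have h4 := congrArg (fun y => (e y : c.LocTensor U)) h3
    simp only [map_smul] at h4
    rw [Submodule.coe_smul, coordRing_smul_eq, coe_symbol_param e he hη,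
      coe_symbol_param e he hη, coe_symbol_param e he hη, map_smul] at h4
    have hu : IsUnit (algebraMap (CoordRing g) c.LocRing s) :=
      IsLocalization.map_units c.LocRing (⟨s, hs⟩ : Submonoid.powers c.minor)
    exact (hu.smul_left_cancel.1 (hu.smul_left_cancel.1 h4)).symm
  have hne : (⊤ : Submodule (CoordRing g) M) ≠ ⊥ := by
    intro h
    apply hbot
    rw [eq_bot_iff]
    intro x _
    have : x ∈ (⊤ : Submodule (CoordRing g) M) := trivial
    rw [h] at this
    simpa using this
  -- The image of M may be smaller than the local model, but its span over the localization contains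
  -- all a ⊗ u. The idempotency relation is linear over the localization, so it reaches a ⊗ u and
  -- then u itself.
  obtain ⟨a, ha, hspan⟩ := exists_smul_mem_span_map_of_stable e he ⊤ hne fun _ _ _ => trivial
  have hidem : ∀ (i : Fin (dim g)) (u : U), ⁅(Matrix.single i i 1 : Gl g),
      ⁅(Matrix.single i i 1 : Gl g), u⁆⁆ = ⁅(Matrix.single i i 1 : Gl g), u⁆ := by
    intro i u
    let E := (LieModule.toEnd K (Gl g) U (Matrix.single i i 1)).baseChange c.LocRing
    have h1 : Submodule.span c.LocRing ((fun x : M => (e x : c.LocTensor U)) ''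
        (⊤ : Submodule (CoordRing g) M)) ≤ LinearMap.eqLocus (E ∘ₗ E) E := by
      rw [Submodule.span_le]
      rintro _ ⟨x, -, rfl⟩
      exact hloc i x
    have h2 : E (E (a • (1 ⊗ₜ u))) = E (a • (1 ⊗ₜ u)) := h1 (hspan (1 ⊗ₜ u))
    rw [TensorProduct.smul_tmul', smul_eq_mul, mul_one] at h2
    simp only [E, LinearMap.baseChange_tmul, LieModule.toEnd_apply_apply] at h2
    rw [← sub_eq_zero, ← TensorProduct.tmul_sub] at h2
    exact sub_eq_zero.1 (eq_zero_of_tmul_eq_zero ha h2)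
  refine exists_sum_lie_eq_natCast_smul (K := K) (fun i => (Matrix.single i i 1 : Gl g)) ?_ hidem ?_
  · intro i j
    rcases eq_or_ne i j with rfl | h
    · exact lie_self _
    · rw [Ring.lie_def, Matrix.single_mul_single_of_ne _ _ _ _ h,
        Matrix.single_mul_single_of_ne _ _ _ _ h.symm, sub_zero]
  · intro x
    rw [Matrix.sum_single_one, Ring.lie_def, mul_one, one_mul, sub_self]
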